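/- Let $p$ be a prime and let $(S,\mathcal F,\mathcal L)$ be a $p$-local finite group: $S$ is a finite $p$-group, $\mathcal F$ a saturated fusion system over $S$, and $\mathcal L$ a centric linking system associated to $\mathcal F$, with structural functors $\delta:\mathcal T^c_S(S)\to\mathcal L$ and $\pi:\mathcal L\to\mathcal F$. Let $\pi_{\mathcal L}=\pi_1(|\mathcal L|,S)$ be the fundamental group of the geometric realization of $\mathcal L$ based at the vertex $S$. For $\psi\in\mathrm{Mor}_{\mathcal L}(P,Q)$ let $\omega(\psi)\in\pi_{\mathcal L}$ be the class of the loop which runs from $S$ back along the edge $\iota_P=\delta_{P,S}(1)$, then along $\psi$, then along $\iota_Q=\delta_{Q,S}(1)$. The product in $\pi_{\mathcal L}$ is written in the order of composition of morphisms, so that $\omega(\chi\circ\psi)=\omega(\chi)\omega(\psi)$. Let $M$ be a finite abelian $p$-group, regarded as a $\mathbb Z_{(p)}$-module, with an action of $\pi_{\mathcal L}$. The group $S$ acts on $M$ through $g\mapsto\omega(\delta_S(g))$. If $\psi\in\mathrm{Mor}_{\mathcal L}(Q,Q')$, $P_0\le Q$, $P_1\le Q'$ and $\pi(\psi)(P_0)\le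 P_1$, let $H^*(\pi(\psi)|^{P_1}_{P_0},\omega(\psi)^{-1}):H^*(P_1,M)\to H^*(P_0,M)$ be the map induced by the restriction $P_0\to P_1$ of $\pi(\psi)$ and by the action of $\omega(\psi)^{-1}$ on $M$. For $P$ $\mathcal F$-centric and $\varphi\in\mathrm{Hom}_{\mathcal F}(P,S)$ put $\varphi^*=H^*(\pi(\psi),\omega(\psi)^{-1}):H^*(S,M)\to H^*(P,M)$, where $\psi\in\mathrm{Mor}_{\mathcal L}(P,S)$ satisfies $\pi(\psi)=\varphi$ (this does not depend on $\psi$). Let $H^k(\mathcal F^c,M)\subseteq H^k(S,M)$ be the submodule of $\mathcal F^c$-stable elements, i.e. of those $x$ with $\varphi^*(x)=\mathrm{Res}^S_P(x)$ for every $\mathcal F$-centric $P\le S$ and every $\varphi\in\mathrm{Hom}_{\mathcal F}(P,S)$. For $P\le S$ and $\varphi\in\mathrm{Hom}_{\mathcal F}(P,S)$ let $[P,\varphi]$ be the $(S,S)$-biset $(S\times S)/\{(x,\varphi(x)):x\in P\}$, in which $s$ acts on the left through $(s,1)$ and on the right through $(1,s^{-1})$. An $\mathcal F$-characteristic biset is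 a finite left-free $(S,S)$-biset $\Omega$ such that: $\Omega$ is isomorphic to a disjoint union of bisets of the form $[P,\varphi]$ with $P\le S$ and $\varphi\in\mathrm{Hom}_{\mathcal F}(P,S)$; for all $P\le S$ and $\varphi\in\mathrm{Hom}_{\mathcal F}(P,S)$, restricting the left action of $S$ on $\Omega$ to $P$ along $\varphi$ or along the inclusion gives isomorphic $(P,S)$-bisets, and restricting the right action in these two ways gives isomorphic $(S,P)$-bisets; and $|\Omega|/|S|\not\equiv 0 \pmod p$. A $[P,\varphi]$-endomorphism of $H^*(S,M)$ is a composite $$\mathrm{tr}^S_P\circ H^*\big(\pi(\psi_1)|^{P_1}_{P_0},\omega(\psi_1)^{-1}\big)\circ\cdots\circ H^*\big(\pi(\psi_r)|^{P_r}_{P_{r-1}},\omega(\psi_r)^{-1}\big)\circ\mathrm{Res}^S_{P_r},$$ where $P=P_0,P_1,\dots,P_r=\varphi(P)$ are subgroups of $S$, each $\psi_i$ is an automorphism in $\mathcal L$ of an $\mathcal F$-centric subgroup containing $P_{i-1}$ and $P_i$, $\pi(\psi_i)(P_{i-1})=P_i$, and $\varphi$ is the composite of the restrictions $\pi(\psi_1)|^{P_1}_{P_0},\dots,\pi(\psi_r)|^{P_r}_{P_{r-1}}$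 followed by the inclusion $P_r\le S$. An $\Omega$-endomorphism is a sum $\sum_i\lambda_i$, where $\Omega\cong\coprod_i[P_i,\varphi_i]$ with $\varphi_i\in\mathrm{Hom}_{\mathcal F}(P_i,S)$ and each $\lambda_i$ is a $[P_i,\varphi_i]$-endomorphism. Let $\Omega$ be an $\mathcal F$-characteristic biset and let $\omega_*=(\omega_k)_{k\ge0}$ be an $\Omega$-endomorphism of $H^*(S,M)$. Then $\frac{|S|}{|\Omega|}$ lies in $\mathbb Z_{(p)}$, and for every $k\ge 0$ there is a natural number $N>0$ such that $\left(\frac{|S|}{|\Omega|}\omega_k\right)^{N}$ is an idempotent endomorphism of $H^k(S,M)$ with $$H^k(\mathcal F^c,M)\subseteq \mathrm{Im}\left(\left(\tfrac{|S|}{|\Omega|}\omega_k\right)^{N}\right).$$ -/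

import Mathlib

open CategoryTheory Opposite

/-! ## The geometric realization of a category: vertices, edges and the fundamental groupoid -/

namespace NerveRealization

open Simplicial

variable {C : Type} [SmallCategory C]

/-- The continuous map from the topological `n`-simplex to `|C|` given by an `n`-simplex of the
nerve (the unit of the adjunction between realization and singular simplicial set). -/
noncomputable def simplexMap {n : ℕ} (x : (nerve C).obj (op ⦋n⦌)) :
    C(stdSimplex ℝ (Fin (n + 1)), SSet.toTop.obj (nerve C)) :=
  TopCat.toSSetObjEquiv _ _ ((sSetTopAdj.unit.app (nerve C)).app _ x)

theorem simplexMap_δ {n : ℕ} (x : (nerve C).obj (op ⦋n + 1⦌)) (i : Fin (n + 2))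
    (z : stdSimplex ℝ (Fin (n + 1))) :
    simplexMap ((nerve C).δ i x) z = simplexMap x (stdSimplex.map i.succAbove z) := by
  unfold simplexMap
  have h := ConcreteCategory.congr_hom
    ((sSetTopAdj.unit.app (nerve C)).naturality (SimplexCategory.δ i).op) x
  have h2 := congrArg (fun y => TopCat.toSSetObjEquiv _ _ y z) h
  exact h2

/-- The vertex of `|C|` given by an object of `C`. -/
noncomputable def vertex (c : C) : SSet.toTop.obj (nerve C) :=
  simplexMap (ComposableArrows.mk₀ c) (stdSimplex.vertex 0)

theorem simplexMap_vertex_zero {c d : C} (f : c ⟶ d) :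
    simplexMap (ComposableArrows.mk₁ f : (nerve C).obj (op ⦋1⦌)) (stdSimplex.vertex 0) = vertex c := by
  have h : (nerve C).δ 1 (ComposableArrows.mk₁ f : (nerve C).obj (op ⦋1⦌))
      = ComposableArrows.mk₀ c := ComposableArrows.ext₀ rfl
  rw [vertex, ← h]
  refine Eq.trans ?_ (simplexMap_δ _ _ _).symm
  rw [stdSimplex.map_vertex]; rfl

theorem simplexMap_vertex_one {c d : C} (f : c ⟶ d) :
    simplexMap (ComposableArrows.mk₁ f : (nerve C).obj (op ⦋1⦌)) (stdSimplex.vertex 1) = vertex d := by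
  have h : (nerve C).δ 0 (ComposableArrows.mk₁ f : (nerve C).obj (op ⦋1⦌))
      = ComposableArrows.mk₀ d := ComposableArrows.ext₀ rfl
  rw [vertex, ← h]
  refine Eq.trans ?_ (simplexMap_δ _ _ _).symm
  rw [stdSimplex.map_vertex]; rfl

/-- The edge of `|C|` given by a morphism of `C`, as a path. -/
noncomputable def edgePath {c d : C} (f : c ⟶ d) : Path (vertex c) (vertex d) where
  toFun t := simplexMap (ComposableArrows.mk₁ f : (nerve C).obj (op ⦋1⦌))
    (stdSimplexHomeomorphUnitInterval.symm t)
  continuous_toFun := by fun_prop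
  source' := by
    rw [← simplexMap_vertex_zero f]
    congr 1; rw [Homeomorph.symm_apply_eq]; simp
  target' := by
    rw [← simplexMap_vertex_one f]
    congr 1; rw [Homeomorph.symm_apply_eq]; simp

/-- The homotopy class of the edge of `|C|` given by a morphism of `C`. -/
noncomputable def edge {c d : C} (f : c ⟶ d) :
    FundamentalGroupoid.mk (vertex c) ⟶ FundamentalGroupoid.mk (vertex d) :=
  Path.Homotopic.Quotient.mk (edgePath f)

theorem homotopic_of_lift {X Y : Type} [TopologicalSpace X] [TopologicalSpace Y]
    [SimplyConnectedSpace Y] (σ : C(Y, X)) {a b c : X} {a' b' c' : Y}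
    (p : Path a b) (q : Path b c) (r : Path a c)
    (p' : Path a' b') (q' : Path b' c') (r' : Path a' c')
    (hp : ∀ t, p t = σ (p' t)) (hq : ∀ t, q t = σ (q' t)) (hr : ∀ t, r t = σ (r' t)) :
    (p.trans q).Homotopic r := by
  obtain rfl : a = σ a' := by simpa using hp 0
  obtain rfl : b = σ b' := by simpa using hp 1
  obtain rfl : c = σ c' := by simpa using hq 1
  obtain rfl : p = p'.map σ.continuous := by ext t; exact hp t
  obtain rfl : q = q'.map σ.continuous := by ext t; exact hq t
  obtain rfl : r = r'.map σ.continuous := by ext t; exact hr t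
  rw [← Path.map_trans]
  exact (SimplyConnectedSpace.paths_homotopic (p'.trans q') r').map σ

/-- The path in the topological `2`-simplex along the face opposite to the vertex `i`. -/
noncomputable def facePath (i : Fin 3) {a b : Fin 3} (ha : i.succAbove 0 = a)
    (hb : i.succAbove 1 = b) :
    Path (stdSimplex.vertex a : stdSimplex ℝ (Fin 3)) (stdSimplex.vertex b) where
  toFun t := stdSimplex.map i.succAbove (stdSimplexHomeomorphUnitInterval.symm t)
  continuous_toFun := (stdSimplex.continuous_map _).comp (by fun_prop)
  source' := by
    have : stdSimplexHomeomorphUnitInterval.symm 0 = stdSimplex.vertex 0 := by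
      rw [Homeomorph.symm_apply_eq]; simp
    rw [this, stdSimplex.map_vertex, ha]
  target' := by
    have : stdSimplexHomeomorphUnitInterval.symm 1 = stdSimplex.vertex 1 := by
      rw [Homeomorph.symm_apply_eq]; simp
    rw [this, stdSimplex.map_vertex, hb]

theorem edgePath_apply_of_face {c d : C} (f : c ⟶ d) (x : (nerve C).obj (op ⦋2⦌)) (i : Fin 3)
    (h : (nerve C).δ i x = ComposableArrows.mk₁ f) {a b : Fin 3} (ha : i.succAbove 0 = a)
    (hb : i.succAbove 1 = b) (t : unitInterval) :
    edgePath f t = simplexMap x (facePath i ha hb t) := by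
  refine Eq.trans ?_ (simplexMap_δ x i _)
  rw [h]; rfl

theorem edge_comp {c d e : C} (f : c ⟶ d) (g : d ⟶ e) : edge (f ≫ g) = edge f ≫ edge g := by
  have : ContractibleSpace (stdSimplex ℝ (Fin 3)) :=
    (convex_stdSimplex ℝ (Fin 3)).contractibleSpace
      ⟨_, (stdSimplex.vertex (S := ℝ) (0 : Fin 3)).2⟩
  refine (Path.Homotopic.Quotient.eq.2 ?_).symm
  exact homotopic_of_lift (simplexMap (ComposableArrows.mk₂ f g : (nerve C).obj (op ⦋2⦌))) _ _ _ _ _ _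
    (edgePath_apply_of_face f _ 2 (nerve.δ₂_mk₂_eq f g) (a := 0) (b := 1) rfl rfl)
    (edgePath_apply_of_face g _ 0 (nerve.δ₀_mk₂_eq f g) (b := 2) rfl rfl)
    (edgePath_apply_of_face (f ≫ g) _ 1 (nerve.δ₁_mk₂_eq f g) rfl rfl)

theorem edge_id (c : C) : edge (𝟙 c) = 𝟙 _ := by
  have h := edge_comp (𝟙 c) (𝟙 c)
  rw [Category.comp_id] at h
  rw [← cancel_mono (edge (𝟙 c)), ← h, Category.id_comp]

end NerveRealization

/-! ## Transfer in group cohomology -/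

namespace GroupTransfer

variable {R G : Type} [CommRing R] [Group G] (H : Subgroup G) (A : Rep.{0} R G)

/-- The summand `g • f (g⁻¹)` of the trace, which depends only on the coset `gH`. -/
def traceTerm (f : Rep.coind H.subtype (Rep.res H.subtype A)) (q : G ⧸ H) : A :=
  Quotient.liftOn' q (fun g => A.ρ g (f.1 g⁻¹)) (by
    intro a b hab
    obtain ⟨h, rfl⟩ : ∃ h : H, b = a * h :=
      ⟨⟨a⁻¹ * b, QuotientGroup.leftRel_apply.1 hab⟩, by simp⟩
    have h1 := f.2 h⁻¹ a⁻¹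
    simp only [Subgroup.coe_subtype, InvMemClass.coe_inv] at h1
    simp only [mul_inv_rev, h1, map_mul]
    simp [← Module.End.mul_apply, ← map_mul])

/-- The trace `Coind_H^G (Res A) ⟶ A`, `f ↦ ∑_{gH ∈ G/H} g • f (g⁻¹)`. -/
noncomputable def trace [Finite G] : Rep.coind H.subtype (Rep.res H.subtype A) ⟶ A :=
  Rep.ofHom (σ := A.ρ)
    { toFun := fun f => ∑ᶠ q : G ⧸ H, traceTerm H A f q
      map_add' := fun f f' => by
        rw [← finsum_add_distrib (Set.toFinite _) (Set.toFinite _)]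
        refine finsum_congr fun q => ?_
        induction q using QuotientGroup.induction_on with
        | H g => exact map_add (A.ρ g) _ _
      map_smul' := fun r f => by
        rw [RingHom.id_apply, smul_finsum' _ (Set.toFinite _)]
        refine finsum_congr fun q => ?_
        induction q using QuotientGroup.induction_on with
        | H g => exact map_smul (A.ρ g) _ _
      isIntertwining' := fun x => by
        ext f
        change ∑ᶠ q : G ⧸ H, traceTerm H A _ q = A.ρ x (∑ᶠ q : G ⧸ H, traceTerm H A f q)
        rw [map_finsum _ (Set.toFinite _), ← finsum_comp_equiv (MulAction.toPerm x : Equiv.Perm (G ⧸ H))]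
        refine finsum_congr fun q => ?_
        induction q using QuotientGroup.induction_on with
        | H g =>
          change A.ρ (x * g) (f.1 ((x * g)⁻¹ * x)) = A.ρ x (A.ρ g (f.1 g⁻¹))
          simp [← Module.End.mul_apply, ← map_mul] }

/-- The transfer `H^k(H, A) ⟶ H^k(G, A)`: Shapiro's isomorphism
`H^k(H, A) ≅ H^k(G, Coind_H^G A)` followed by the map induced by the trace. -/
noncomputable def transfer [Finite G] (k : ℕ) :
    groupCohomology (Rep.res H.subtype A) k ⟶ groupCohomology A k :=
  (groupCohomology.coindIso (Rep.res H.subtype A) k).inv ≫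
    groupCohomology.map (MonoidHom.id G) (trace H A) k

end GroupTransfer

/-! ## Fusion systems -/

section Fusion

variable {S : Type} [Group S]

/-- The transporter `T_S(P, Q) = {g ∈ S | g P g⁻¹ ≤ Q}`. -/
def transporter (P Q : Subgroup S) : Set S := {g | ∀ x ∈ P, g * x * g⁻¹ ∈ Q}

theorem one_mem_transporter {P Q : Subgroup S} (h : P ≤ Q) : (1 : S) ∈ transporter P Q :=
  fun x hx => by simpa using h hx

theorem mul_mem_transporter {P Q R : Subgroup S} {g h : S} (hg : g ∈ transporter P Q)
    (hh : h ∈ transporter Q R) : h * g ∈ transporter P R :=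
  fun x hx => by simpa [mul_assoc] using hh _ (hg x hx)

theorem mem_transporter_self {P : Subgroup S} {g : S} (hg : g ∈ P) : g ∈ transporter P P :=
  fun _ hx => P.mul_mem (P.mul_mem hg hx) (P.inv_mem hg)

theorem centralizer_mem_transporter {P : Subgroup S} {g : S}
    (hg : g ∈ Subgroup.centralizer (P : Set S)) : g ∈ transporter P P := fun x hx => by
  rw [← Subgroup.mem_centralizer_iff.1 hg x hx]; simpa using hx

/-- The conjugation homomorphism `c_g : P → Q`, `x ↦ g x g⁻¹`, for `g ∈ T_S(P, Q)`. -/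
def conjHom {P Q : Subgroup S} (g : S) (hg : g ∈ transporter P Q) : P →* Q :=
  ((MulAut.conj g).toMonoidHom.comp P.subtype).codRestrict Q fun x => hg x x.2

/-- A fusion system over `S`: a category whose objects are the subgroups of `S`, whose morphisms are
injective group homomorphisms, which contains all conjugations by elements of `S`, and in which each
morphism is an isomorphism of the category followed by an inclusion. -/
structure FusionSystem (S : Type) [Group S] where
  /-- The morphisms from `P` to `Q`. -/
  Hom (P Q : Subgroup S) : Set (P →* Q)
  conj_mem {P Q : Subgroup S} (g : S) (hg : g ∈ transporter P Q) : conjHom g hg ∈ Hom P Q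
  injective {P Q : Subgroup S} (φ : P →* Q) (hφ : φ ∈ Hom P Q) : Function.Injective φ
  comp_mem {P Q R : Subgroup S} (φ : P →* Q) (ψ : Q →* R) (hφ : φ ∈ Hom P Q) (hψ : ψ ∈ Hom Q R) :
    ψ.comp φ ∈ Hom P R
  factor {P Q : Subgroup S} (φ : P →* Q) (hφ : φ ∈ Hom P Q) :
    ∃ (R : Subgroup S) (hR : R ≤ Q) (e : P ≃* R), e.toMonoidHom ∈ Hom P R ∧
      e.symm.toMonoidHom ∈ Hom R P ∧ φ = (Subgroup.inclusion hR).comp e.toMonoidHom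

namespace FusionSystem

variable (F : FusionSystem S)

/-- A group isomorphism which is an isomorphism in the category `F`. -/
def IsIso {P Q : Subgroup S} (e : P ≃* Q) : Prop :=
  e.toMonoidHom ∈ F.Hom P Q ∧ e.symm.toMonoidHom ∈ F.Hom Q P

/-- Two subgroups are `F`-conjugate if they are isomorphic in `F`. -/
def Conj (P Q : Subgroup S) : Prop := ∃ e : P ≃* Q, F.IsIso e

/-- `P` is `F`-centric if `C_S(Q) = Z(Q)` for every `F`-conjugate `Q` of `P`. -/
def IsCentric (P : Subgroup S) : Prop :=
  ∀ Q : Subgroup S, F.Conj P Q →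
    Subgroup.centralizer (Q : Set S) = (Subgroup.center Q).map Q.subtype

/-- The `F`-centric subgroups of `S`. -/
abbrev Centric : Type := {P : Subgroup S // F.IsCentric P}

/-- `P` is fully centralized if `|C_S(P)| ≥ |C_S(Q)|` for every `F`-conjugate `Q` of `P`. -/
def FullyCentralized (P : Subgroup S) : Prop :=
  ∀ Q : Subgroup S, F.Conj P Q →
    Nat.card (Subgroup.centralizer (Q : Set S)) ≤ Nat.card (Subgroup.centralizer (P : Set S))

/-- `Aut_F(P)`. -/
def aut (P : Subgroup S) : Subgroup (MulAut P) where
  carrier := {e | F.IsIso e}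
  one_mem' := by
    have h : MonoidHom.id P = conjHom 1 (one_mem_transporter le_rfl) := by
      ext x; simp [conjHom]
    have h' := F.conj_mem 1 (one_mem_transporter (le_refl P))
    rw [← h] at h'
    exact ⟨h', h'⟩
  mul_mem' := fun {a b} ha hb => ⟨F.comp_mem _ _ hb.1 ha.1, F.comp_mem _ _ ha.2 hb.2⟩
  inv_mem' := fun {a} ha => ⟨ha.2, ha.1⟩

/-- `Aut_S(P)`, the automorphisms of `P` given by conjugation by elements of `N_S(P)`. -/
def autS (P : Subgroup S) : Subgroup (MulAut P) := P.normalizerMonoidHom.range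

/-- `P` is fully automized if `Aut_S(P)` is a Sylow `p`-subgroup of `Aut_F(P)`. -/
def FullyAutomized (p : ℕ) (P : Subgroup S) : Prop :=
  ∃ T : Sylow p (F.aut P), (T : Subgroup (F.aut P)) = (autS P).subgroupOf (F.aut P)

/-- For `e : Q ≃* P`, the subgroup `N_e = {g ∈ N_S(Q) | e c_g e⁻¹ ∈ Aut_S(P)}` of `S`. -/
def extender {P Q : Subgroup S} (e : Q ≃* P) : Subgroup S :=
  ((autS P).comap ((MulAut.congr e).toMonoidHom.comp Q.normalizerMonoidHom)).map
    (Subgroup.normalizer (Q : Set S)).subtype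

/-- `P` is receptive if each isomorphism `e : Q ≃* P` of `F` extends to a morphism of `F`
from `N_e` to `S`. -/
def Receptive (P : Subgroup S) : Prop :=
  ∀ (Q : Subgroup S) (e : Q ≃* P), F.IsIso e →
    ∃ ψ ∈ F.Hom (extender e) ⊤,
      ∀ (x : extender e) (hx : (x : S) ∈ Q), ((ψ x : (⊤ : Subgroup S)) : S) = e ⟨x, hx⟩

/-- `F` is saturated if each subgroup of `S` is `F`-conjugate to a subgroup which is fully automized
and receptive. -/
def IsSaturated (p : ℕ) : Prop :=
  ∀ P : Subgroup S, ∃ Q : Subgroup S, F.Conj P Q ∧ F.FullyAutomized p Q ∧ F.Receptive Q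

theorem isCentric_top [Finite S] : F.IsCentric ⊤ := by
  rintro Q ⟨e, -⟩
  have hQ : Q = ⊤ := Subgroup.eq_top_of_card_eq Q (by
    rw [← Nat.card_congr e.toEquiv]; exact Subgroup.card_top)
  subst hQ
  ext x
  simp only [Subgroup.mem_centralizer_iff, Subgroup.mem_map, Subgroup.mem_center_iff]
  constructor
  · intro h
    exact ⟨⟨x, trivial⟩, fun g => Subtype.ext (h g trivial), rfl⟩
  · rintro ⟨y, hy, rfl⟩ g -
    exact congrArg Subtype.val (hy ⟨g, trivial⟩)

end FusionSystem

/-! ## Centric linking systems -/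

/-- A centric linking system associated to `F`: a finite category `L` on the `F`-centric subgroups,
with functors `δ : T_S^c(S) ⥤ L` and `π : L ⥤ F` which are the identity and the inclusion on
objects, satisfying the axioms (A), (B) and (C). In `comp ψ χ` the morphism `ψ` comes first. -/
structure LinkingSystem (F : FusionSystem S) where
  /-- The morphisms of the linking system. -/
  Mor : F.Centric → F.Centric → Type
  finite_mor : ∀ P Q, Finite (Mor P Q)
  /-- Identities. -/
  one : ∀ P, Mor P P
  /-- Composition, in diagrammatic order. -/
  comp : ∀ {P Q R}, Mor P Q → Mor Q R → Mor P R
  one_comp : ∀ {P Q} (ψ : Mor P Q), comp (one P) ψ = ψ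
  comp_one : ∀ {P Q} (ψ : Mor P Q), comp ψ (one Q) = ψ
  assoc : ∀ {P Q R T} (ψ : Mor P Q) (χ : Mor Q R) (θ : Mor R T),
    comp (comp ψ χ) θ = comp ψ (comp χ θ)
  /-- The functor `δ` on morphisms. -/
  δ : ∀ {P Q : F.Centric}, transporter P.1 Q.1 → Mor P Q
  δ_one : ∀ P : F.Centric, δ ⟨1, one_mem_transporter (le_refl P.1)⟩ = one P
  δ_comp : ∀ {P Q R : F.Centric} (g : transporter P.1 Q.1) (h : transporter Q.1 R.1),
    δ ⟨h * g, mul_mem_transporter g.2 h.2⟩ = comp (δ g) (δ h)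
  /-- The functor `π` on morphisms. -/
  π : ∀ {P Q : F.Centric}, Mor P Q → (P.1 →* Q.1)
  π_mem : ∀ {P Q : F.Centric} (ψ : Mor P Q), π ψ ∈ F.Hom P.1 Q.1
  π_one : ∀ P : F.Centric, π (one P) = MonoidHom.id P.1
  π_comp : ∀ {P Q R : F.Centric} (ψ : Mor P Q) (χ : Mor Q R), π (comp ψ χ) = (π χ).comp (π ψ)
  /-- Axiom (A): `C_S(P)` acts freely on `Mor_L(P, Q)` through `δ_P` and right composition. -/
  free : ∀ {P Q : F.Centric}, F.FullyCentralized P.1 → ∀ (ψ : Mor P Q) (c : S)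
    (hc : c ∈ Subgroup.centralizer (P.1 : Set S)),
    comp (δ ⟨c, centralizer_mem_transporter hc⟩) ψ = ψ → c = 1
  /-- Axiom (A): `π` maps onto `Hom_F(P, Q)`. -/
  π_surj : ∀ {P Q : F.Centric}, F.FullyCentralized P.1 → ∀ φ ∈ F.Hom P.1 Q.1, ∃ ψ : Mor P Q, π ψ = φ
  /-- Axiom (A): the fibres of `π` are the orbits of `C_S(P)`. -/
  π_eq_iff : ∀ {P Q : F.Centric}, F.FullyCentralized P.1 → ∀ ψ ψ' : Mor P Q,
    π ψ = π ψ' ↔ ∃ (c : S) (hc : c ∈ Subgroup.centralizer (P.1 : Set S)),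
      ψ' = comp (δ ⟨c, centralizer_mem_transporter hc⟩) ψ
  /-- Axiom (B). -/
  π_δ : ∀ {P Q : F.Centric} (g : transporter P.1 Q.1), π (δ g) = conjHom g.1 g.2
  /-- Axiom (C). -/
  comp_δ : ∀ {P Q : F.Centric} (ψ : Mor P Q) (g : P.1),
    comp ψ (δ ⟨π ψ g, mem_transporter_self (π ψ g).2⟩) =
      comp (δ ⟨g, mem_transporter_self g.2⟩) ψ

namespace LinkingSystem

variable {F : FusionSystem S} (L : LinkingSystem F)

/-- The objects of `L`, as a category. -/
def Obj (_ : LinkingSystem F) : Type := F.Centric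

instance : SmallCategory L.Obj where
  Hom := L.Mor
  id := L.one
  comp := L.comp
  id_comp := L.one_comp
  comp_id := L.comp_one
  assoc := L.assoc

/-- The subgroup of `S` underlying an object of `L`. -/
def Obj.sub {L : LinkingSystem F} (P : L.Obj) : Subgroup S := Subtype.val (p := F.IsCentric) P

/-- The functor `π`. -/
def proj {P Q : L.Obj} (ψ : P ⟶ Q) : P.sub →* Q.sub := L.π ψ

/-- The functor `δ`. -/
def del {P Q : L.Obj} (g : S) (hg : g ∈ transporter P.sub Q.sub) : P ⟶ Q := L.δ ⟨g, hg⟩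

theorem del_comp {P Q R : L.Obj} (g h : S) (hg : g ∈ transporter P.sub Q.sub)
    (hh : h ∈ transporter Q.sub R.sub) :
    L.del g hg ≫ L.del h hh = L.del (h * g) (mul_mem_transporter hg hh) :=
  (L.δ_comp ⟨g, hg⟩ ⟨h, hh⟩).symm

theorem comp_del {P Q : L.Obj} (ψ : P ⟶ Q) (g : P.sub) :
    ψ ≫ L.del (L.proj ψ g) (mem_transporter_self (L.proj ψ g).2) =
      L.del (g : S) (mem_transporter_self g.2) ≫ ψ :=
  L.comp_δ ψ g

theorem proj_mem_of_map_eq {L : LinkingSystem F} {Q : L.Obj} {ψ : Q ⟶ Q} {P₀ P₁ : Subgroup S}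
    (h₀ : P₀ ≤ Q.sub) (h : (P₀.subgroupOf Q.sub).map (L.proj ψ) = P₁.subgroupOf Q.sub) (x : P₀) :
    (L.proj ψ (Subgroup.inclusion h₀ x) : S) ∈ P₁ := by
  have : L.proj ψ (Subgroup.inclusion h₀ x) ∈ P₁.subgroupOf Q.sub := by
    rw [← h]
    exact Subgroup.mem_map_of_mem _ x.2
  exact this

variable [Finite S]

/-- The object `S` of `L`. -/
def top : L.Obj := ⟨⊤, F.isCentric_top⟩

theorem mem_transporter_top {P : Subgroup S} (g : S) : g ∈ transporter P L.top.sub :=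
  fun _ _ => Subgroup.mem_top _

/-- `ι_P = δ_{P,S}(1)`. -/
def iota (P : L.Obj) : P ⟶ L.top := L.del 1 (L.mem_transporter_top 1)

/-- `π_L = π_1(|L|, S)`. -/
abbrev piOne : Type :=
  FundamentalGroup (SSet.toTop.obj (nerve L.Obj)) (NerveRealization.vertex L.top)

/-- The class in `π_L` of the loop `ι_Q . ψ . ι_P⁻¹`, for `ψ ∈ Mor_L(P, Q)`: from the vertex `S` back
along the edge `ι_P`, then along `ψ`, then along `ι_Q`. -/
noncomputable def omega {P Q : L.Obj} (ψ : P ⟶ Q) : L.piOne :=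
  Groupoid.inv (NerveRealization.edge (L.iota P)) ≫ NerveRealization.edge ψ ≫
    NerveRealization.edge (L.iota Q)

theorem omega_id (P : L.Obj) : L.omega (𝟙 P) = 1 := by
  simp [omega, NerveRealization.edge_id, End.one_def]

theorem omega_comp {P Q R : L.Obj} (ψ : P ⟶ Q) (χ : Q ⟶ R) :
    L.omega (ψ ≫ χ) = L.omega χ * L.omega ψ := by
  simp [omega, NerveRealization.edge_comp, End.mul_def]

/-- The homomorphism `S → π_L`, `g ↦ ω(δ_S(g))`. -/
noncomputable def deltaS : S →* L.piOne where
  toFun g := L.omega (L.del (P := L.top) (Q := L.top) g (L.mem_transporter_top g))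
  map_one' := by
    rw [← L.omega_id L.top]
    exact congrArg _ (L.δ_one _)
  map_mul' g h := by
    rw [← L.omega_comp, L.del_comp]

theorem omega_iota (P : L.Obj) : L.omega (L.iota P) = 1 := by
  have h : L.iota L.top = 𝟙 _ := L.δ_one _
  simp [omega, h, NerveRealization.edge_id, End.one_def]

theorem omega_del (P : L.Obj) (g : S) (hg : g ∈ transporter P.sub P.sub) :
    L.omega (L.del (P := P) (Q := P) g hg) = L.deltaS g := by
  have h : L.del (P := P) (Q := P) g hg ≫ L.iota P =
      L.iota P ≫ L.del (P := L.top) (Q := L.top) g (L.mem_transporter_top g) := by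
    simp only [iota, del_comp, one_mul, mul_one]
  have h2 := congrArg L.omega h
  rw [omega_comp, omega_comp, omega_iota, one_mul, mul_one] at h2
  exact h2

theorem omega_mul_deltaS {P Q : L.Obj} (ψ : P ⟶ Q) (g : P.sub) :
    L.omega ψ * L.deltaS g = L.deltaS (L.proj ψ g) * L.omega ψ := by
  have h := congrArg L.omega (L.comp_del ψ g)
  rw [omega_comp, omega_comp, omega_del, omega_del] at h
  exact h.symm

/-! ## Cohomology with twisted coefficients -/

section Cohomology

variable {R M : Type} [CommRing R] [AddCommGroup M] [Module R M] (ρ : Representation R L.piOne M)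

/-- `M` as an `R[S]`-module. -/
noncomputable abbrev repS : Rep.{0} R S := Rep.of (ρ.comp L.deltaS)

/-- `M` as an `R[P]`-module, for `P ≤ S`. -/
noncomputable abbrev rep (P : Subgroup S) : Rep.{0} R P := Rep.res P.subtype (L.repS ρ)

/-- `Res^S_P : H^k(S, M) ⟶ H^k(P, M)`. -/
noncomputable def resS (P : Subgroup S) (k : ℕ) :
    groupCohomology (L.repS ρ) k ⟶ groupCohomology (L.rep ρ P) k :=
  groupCohomology.map P.subtype (𝟙 _) k

/-- `tr_P^S : H^k(P, M) ⟶ H^k(S, M)`. -/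
noncomputable def trS (P : Subgroup S) (k : ℕ) :
    groupCohomology (L.rep ρ P) k ⟶ groupCohomology (L.repS ρ) k :=
  GroupTransfer.transfer P (L.repS ρ) k

/-- The restriction `P₀ → P₁` of `π(ψ)`, for `P₀ ≤ P`, `P₁ ≤ Q` with `π(ψ)(P₀) ≤ P₁`. -/
def restrict {P Q : L.Obj} (ψ : P ⟶ Q) {P₀ P₁ : Subgroup S} (h₀ : P₀ ≤ P.sub)
    (h : ∀ x : P₀, (L.proj ψ (Subgroup.inclusion h₀ x) : S) ∈ P₁) : P₀ →* P₁ :=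
  (Q.sub.subtype.comp ((L.proj ψ).comp (Subgroup.inclusion h₀))).codRestrict P₁ h

/-- The map `H^k(π(ψ)|, ω(ψ)⁻¹) : H^k(P₁, M) ⟶ H^k(P₀, M)` induced by the restriction `P₀ → P₁` of
`π(ψ)` and by the action of `ω(ψ)⁻¹` on `M`. -/
noncomputable def pull {P Q : L.Obj} (ψ : P ⟶ Q) {P₀ P₁ : Subgroup S} (h₀ : P₀ ≤ P.sub)
    (h : ∀ x : P₀, (L.proj ψ (Subgroup.inclusion h₀ x) : S) ∈ P₁) (k : ℕ) :
    groupCohomology (L.rep ρ P₁) k ⟶ groupCohomology (L.rep ρ P₀) k :=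
  groupCohomology.map (L.restrict ψ h₀ h)
    (Rep.ofHom
      { toLinearMap := ρ (L.omega ψ)⁻¹
        isIntertwining' := fun g => by
          change ρ (L.omega ψ)⁻¹ * ρ (L.deltaS (L.proj ψ (Subgroup.inclusion h₀ g))) =
            ρ (L.deltaS (g : S)) * ρ (L.omega ψ)⁻¹
          rw [← map_mul, ← map_mul]
          congr 1
          have := L.omega_mul_deltaS ψ (Subgroup.inclusion h₀ g)
          rw [inv_mul_eq_iff_eq_mul, ← mul_assoc, eq_mul_inv_iff_mul_eq]
          exact this.symm }) k

/-- The `F^c`-stable elements `H^k(F^c, M)` of `H^k(S, M)`: those `x` with `φ^* x = Res^S_P x` for all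
`F`-centric `P` and all `φ ∈ Hom_F(P, S)`, where `φ^*` is the map induced by a morphism `ψ` of `L`
with `π(ψ) = φ` (it does not depend on `ψ`, and each `φ` has such a `ψ`). -/
noncomputable def stable (k : ℕ) : Submodule R (groupCohomology (L.repS ρ) k) where
  carrier := {x | ∀ (P : L.Obj) (φ : P.sub →* L.top.sub), φ ∈ F.Hom P.sub L.top.sub →
    ∀ ψ : P ⟶ L.top, L.proj ψ = φ →
      L.pull ρ ψ (P₁ := ⊤) le_rfl (fun _ => Subgroup.mem_top _) k (L.resS ρ ⊤ k x) =
        L.resS ρ P.sub k x}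
  add_mem' := fun hx hy P φ hφ ψ hψ => by
    simp only [map_add, hx P φ hφ ψ hψ, hy P φ hφ ψ hψ]
  zero_mem' := fun P φ hφ ψ hψ => by simp only [map_zero]
  smul_mem' := fun r x hx P φ hφ ψ hψ => by simp only [map_smul, hx P φ hφ ψ hψ]

/-- A composable sequence `P = P₀ → P₁ → ⋯ → P_r = P'` of restrictions of automorphisms `ψ_i`, in `L`,
of `F`-centric subgroups `Q_i` containing `P_{i-1}` and `P_i`, with `π(ψ_i)(P_{i-1}) = P_i`. -/
inductive Chain : Subgroup S → Subgroup S → Type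
  | nil (P : Subgroup S) : Chain P P
  | cons {P₀ P₁ P' : Subgroup S} (Q : L.Obj) (ψ : Q ≅ Q) (h₀ : P₀ ≤ Q.sub) (h₁ : P₁ ≤ Q.sub)
      (h : (P₀.subgroupOf Q.sub).map (L.proj ψ.hom) = P₁.subgroupOf Q.sub) (c : Chain P₁ P') :
      Chain P₀ P'

variable {L} in
/-- The composite `P → P' ≤ S` of the homomorphisms of a chain. -/
def Chain.hom : {P P' : Subgroup S} → L.Chain P P' → (P →* S)
  | _, _, .nil P => P.subtype
  | _, _, .cons _ ψ h₀ _ h c => c.hom.comp (L.restrict ψ.hom h₀ (proj_mem_of_map_eq h₀ h))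

variable {L} in
/-- The composite `H^k(P', M) ⟶ ⋯ ⟶ H^k(P₁, M) ⟶ H^k(P, M)` of the maps
`H^k(π(ψ_i)|, ω(ψ_i)⁻¹)` of a chain. -/
noncomputable def Chain.pull (k : ℕ) : {P P' : Subgroup S} → L.Chain P P' →
    (groupCohomology (L.rep ρ P') k ⟶ groupCohomology (L.rep ρ P) k)
  | _, _, .nil _ => 𝟙 _
  | _, _, .cons _ ψ h₀ _ h c =>
      Chain.pull k c ≫ L.pull ρ ψ.hom h₀ (proj_mem_of_map_eq h₀ h) k

/-- `lam` is a `[P, φ]`-endomorphism of `H^*(S, M)`: for some decomposition of `φ` into restrictions of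
automorphisms in `L` of `F`-centric subgroups, it is the composite of `Res^S_{φ(P)}`, the maps induced
by the decomposition, and `tr_P^S`. -/
def IsTransitiveEndo (P : Subgroup S) (φ : P →* (⊤ : Subgroup S))
    (lam : ∀ k, Module.End R (groupCohomology (L.repS ρ) k)) : Prop :=
  ∃ (P' : Subgroup S) (c : L.Chain P P'), c.hom = (⊤ : Subgroup S).subtype.comp φ ∧
    ∀ k, lam k = (L.resS ρ P' k ≫ c.pull ρ k ≫ L.trS ρ P k).hom

end Cohomology

end LinkingSystem

/-! ## Bisets -/

/-- `Δ(P, φ) = {(x, φ(x)) | x ∈ P} ≤ S × S`. -/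
def graphSubgroup (P : Subgroup S) (φ : P →* (⊤ : Subgroup S)) : Subgroup (S × S) :=
  (P.subtype.prod ((⊤ : Subgroup S).subtype.comp φ)).range

section Biset

variable (F : FusionSystem S) (Ω : Type*) [MulAction S Ω] [MulAction Sᵐᵒᵖ Ω]

/-- An isomorphism of the `(S, S)`-biset `Ω` with a finite disjoint union of bisets
`[P_i, φ_i] = (S × S) / Δ(P_i, φ_i)`, `φ_i ∈ Hom_F(P_i, S)`. On `(S × S) / Δ` the element `s` acts on
the left through `(s, 1)` and on the right through `(1, s⁻¹)`. -/
structure BisetDecomposition where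
  /-- The number of components. -/
  n : ℕ
  /-- The subgroups. -/
  P : Fin n → Subgroup S
  /-- The homomorphisms. -/
  φ : ∀ i, P i →* (⊤ : Subgroup S)
  φ_mem : ∀ i, φ i ∈ F.Hom (P i) ⊤
  /-- The isomorphism. -/
  equiv : Ω ≃ Σ i, (S × S) ⧸ graphSubgroup (P i) (φ i)
  equiv_left : ∀ (s : S) (w : Ω), equiv (s • w) = ⟨(equiv w).1, (s, (1 : S)) • (equiv w).2⟩
  equiv_right : ∀ (s : S) (w : Ω),
    equiv (MulOpposite.op s • w) = ⟨(equiv w).1, ((1 : S), s⁻¹) • (equiv w).2⟩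

/-- `Ω` is an `F`-characteristic `(S, S)`-biset. -/
structure IsCharacteristicBiset (p : ℕ) : Prop where
  left_free : ∀ (s : S) (w : Ω), s • w = w → s = 1
  /-- `Ω` is `F`-generated. -/
  generated : Nonempty (BisetDecomposition F Ω)
  /-- Restricting the left action along `φ` or along the inclusion gives isomorphic bisets. -/
  left_stable : ∀ (P : Subgroup S), ∀ φ ∈ F.Hom P ⊤, ∃ e : Ω ≃ Ω,
    (∀ (x : P) (w : Ω), e (((φ x : (⊤ : Subgroup S)) : S) • w) = (x : S) • e w) ∧
    ∀ (s : S) (w : Ω), e (MulOpposite.op s • w) = MulOpposite.op s • e w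
  /-- Restricting the right action along `φ` or along the inclusion gives isomorphic bisets. -/
  right_stable : ∀ (P : Subgroup S), ∀ φ ∈ F.Hom P ⊤, ∃ e : Ω ≃ Ω,
    (∀ (s : S) (w : Ω), e (s • w) = s • e w) ∧
    ∀ (x : P) (w : Ω), e (MulOpposite.op ((φ x : (⊤ : Subgroup S)) : S) • w) =
      MulOpposite.op (x : S) • e w
  /-- `|Ω| / |S|` (an integer, as `Ω` is left-free) is prime to `p`. -/
  nondegenerate : ¬ p ∣ Nat.card Ω / Nat.card S

variable {F} in
/-- `om` is an `Ω`-endomorphism of `H^*(S, M)`: for some decomposition of `Ω` into transitive bisets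
`[P_i, φ_i]`, it is a sum over `i` of `[P_i, φ_i]`-endomorphisms. -/
def LinkingSystem.IsBisetEndo [Finite S] (L : LinkingSystem F) {R M : Type} [CommRing R]
    [AddCommGroup M] [Module R M] (ρ : Representation R L.piOne M)
    (om : ∀ k, Module.End R (groupCohomology (L.repS ρ) k)) : Prop :=
  ∃ (D : BisetDecomposition F Ω)
    (lam : Fin D.n → ∀ k, Module.End R (groupCohomology (L.repS ρ) k)),
    (∀ i, L.IsTransitiveEndo ρ (D.P i) (D.φ i) (lam i)) ∧
    ∀ k, om k = ∑ i, lam i k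

end Biset

end Fusion

/-! ## The ring `ℤ_(p)` -/

instance isPrimeSpan (p : ℕ) [hp : Fact p.Prime] : (Ideal.span {(p : ℤ)}).IsPrime :=
  (Ideal.span_singleton_prime (by exact_mod_cast hp.out.ne_zero)).2
    (Nat.prime_iff_prime_int.1 hp.out)

/-- The ring `ℤ_(p)`. -/
abbrev ZLocal (p : ℕ) [Fact p.Prime] : Type := Localization.AtPrime (Ideal.span {(p : ℤ)})

/-! Every stable class `x` is an eigenvector of `ω_k` with eigenvalue `|Ω|/|S|`. Let `λ` be a `[P,
φ]`-endomorphism along a chain from `P` to `P'`. Stability makes each map of the chain carry the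
restriction of `x` at its target to the restriction of `x` at its source, so the chain takes
`Res_{P'} x` to `Res_P x`. Then `tr ∘ Res` multiplies by `[S : P]`. As `[P, φ]` has `|S| · [S : P]`
points, the indices of the components of `Ω` add up to `|Ω|/|S|`. This integer is prime to `p`,
hence a unit of `ℤ_(p)`, and the rescaled endomorphism fixes every stable class.

Since `S` and `M` are finite, so are `H^k(S, M)` and its endomorphism monoid, where every element
has an idempotent positive power. That power still fixes the stable classes, so its image contains
them.

The long part is `tr ∘ Res = [G : H]` (`GroupTransfer.map_subtype_comp_transfer`), because the
transfer is defined through Shapiro's isomorphism. Restriction turns out to be the map induced by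
the unit `A ⟶ Coind Res A` followed by that isomorphism (`map_coindUnit_comp_coindIso_hom`). So `tr
∘ Res` is induced by unit followed by trace, which is multiplication by the index. Identifying
restriction needs a comparison of two resolutions over `H`: its own bar resolution and the
restricted bar resolution of `G`. -/

section Unop

/-! ### Ext computed from two projective resolutions -/

namespace HomologicalComplex

variable {V ι : Type*} [Category* V] [Limits.HasZeroMorphisms V] {c : ComplexShape ι}
  {K L : HomologicalComplex Vᵒᵖ c}

/-- The morphism of complexes `L.unop ⟶ K.unop` given by a morphism `K ⟶ L` of complexes in `Vᵒᵖ`. -/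
def unopMap (φ : K ⟶ L) : L.unop ⟶ K.unop where
  f i := (φ.f i).unop
  comm' i j _ := congrArg Quiver.Hom.unop (φ.comm j i).symm

variable (φ : K ⟶ L) (i : ι) [K.HasHomology i] [L.HasHomology i]

theorem homologyMap_unopMap_comp_homologyUnop_hom :
    homologyMap (unopMap φ) i ≫ (K.homologyUnop i).hom =
      (L.homologyUnop i).hom ≫ (homologyMap φ i).unop :=
  (congrArg Quiver.Hom.unop (homologyOp_hom_naturality (unopMap φ) i)).symm

/-- The isomorphisms here have the shape in which `isoExt` is built from a left derived functor with
values in the opposite category; a compatibility known there is carried back to `V`. -/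
theorem unop_symm_trans_homologyUnop_symm_comp {T : Vᵒᵖ} (eK : T ≅ K.homology i)
    (eL : T ≅ L.homology i) (h : eK.inv = homologyMap φ i ≫ eL.inv) :
    (eL.unop.symm ≪≫ (L.homologyUnop i).symm).hom ≫ homologyMap (unopMap φ) i =
      (eK.unop.symm ≪≫ (K.homologyUnop i).symm).hom := by
  simp only [Iso.trans_hom, Iso.symm_hom, Iso.unop_inv, h, unop_comp, Category.assoc]
  rw [← cancel_mono (K.homologyUnop i).hom]
  simp [homologyMap_unopMap_comp_homologyUnop_hom]

end HomologicalComplex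

end Unop

section ExtNaturality

variable {R C : Type*} [Ring R] [Category* C] [Abelian C] [Linear R C]

/-- The map of cochain complexes `Hom(Q, Y) ⟶ Hom(P, Y)` induced by a chain map `P ⟶ Q`. -/
noncomputable def ChainComplex.linearYonedaObjMap {P Q : ChainComplex C ℕ} (φ : P ⟶ Q) (Y : C) :
    Q.linearYonedaObj R Y ⟶ P.linearYonedaObj R Y :=
  HomologicalComplex.unopMap ((((linearYoneda R C).obj Y).rightOp.mapHomologicalComplex _).map φ)

variable [EnoughProjectives C]

/-- Naturality of the left derived functor of `Hom(-, Y)` over the identity of `X`, of which `φ` is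
a lift to the resolutions. -/
theorem CategoryTheory.ProjectiveResolution.isoExt_hom_comp_homologyMap {X : C}
    (P Q : ProjectiveResolution X) (φ : P.complex ⟶ Q.complex)
    (comm : φ.f 0 ≫ Q.π.f 0 = P.π.f 0) (n : ℕ) (Y : C) :
    (Q.isoExt (R := R) n Y).hom ≫
      HomologicalComplex.homologyMap (ChainComplex.linearYonedaObjMap φ Y) n =
      (P.isoExt (R := R) n Y).hom := by
  refine HomologicalComplex.unop_symm_trans_homologyUnop_symm_comp
    ((((linearYoneda R C).obj Y).rightOp.mapHomologicalComplex _).map φ) n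
    (P.isoLeftDerivedObj ((linearYoneda R C).obj Y).rightOp n)
    (Q.isoLeftDerivedObj ((linearYoneda R C).obj Y).rightOp n) ?_
  have h := ProjectiveResolution.isoLeftDerivedObj_inv_naturality (𝟙 X) P Q φ
    (comm.trans (Category.comp_id _).symm) ((linearYoneda R C).obj Y).rightOp n
  rw [Functor.map_id] at h
  exact (Category.comp_id _).symm.trans h

end ExtNaturality

/-! ### Restriction, Shapiro's isomorphism and transfer -/

section Shapiro

open Rep

variable {k G : Type} [CommRing k] [Group G] (H : Subgroup G) (A : Rep.{0} k G)

/-- The map of free modules `k[H]^(H^n) ⟶ k[G]^(G^n)` induced by the inclusion `H ≤ G`. -/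
noncomputable def freeInclusion (n : ℕ) :
    free k H (Fin n → H) ⟶ res H.subtype (free k G (Fin n → G)) :=
  freeLift k H (res H.subtype (free k G (Fin n → G)))
    fun h => Finsupp.single (fun i => (h i : G)) (.single 1 1)

theorem freeInclusion_single (n : ℕ) (x : Fin n → H) (g : H) (r : k) :
    (freeInclusion (k := k) H n).hom (Finsupp.single x (.single g r)) =
      (Finsupp.single (fun i => (x i : G)) (.single (g : G) r) :
        (Fin n → G) →₀ MonoidAlgebra k G) := by
  simp [freeInclusion]

/-- The bar differential only multiplies or drops entries, and the inclusion of `H` respects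
products; it is enough to check free generators. -/
theorem freeInclusion_comp_map_d (n : ℕ) :
    freeInclusion (k := k) H (n + 1) ≫ (resFunctor H.subtype).map (barComplex.d k G n) =
      barComplex.d k H n ≫ freeInclusion H n := by
  refine free_ext k H _ _ _ fun x => ?_
  simp only [Rep.hom_comp, Representation.IntertwiningMap.comp_apply]
  rw [barComplex.d_single, freeInclusion_single, map_add, map_sum]
  refine (barComplex.d_single n fun i => (x i : G)).trans ?_
  refine congrArg₂ (· + ·) (freeInclusion_single H _ _ _ _).symm
    (Finset.sum_congr rfl fun j _ => Eq.trans ?_ (freeInclusion_single H _ _ _ _).symm)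
  congr 1
  exact (Fin.comp_contractNth _ _ (f := H.subtype) (fun _ _ => rfl) j x).symm

/-- The chain map from the bar resolution of `H` to the restriction of the bar resolution of `G`. -/
noncomputable def barComplexInclusion :
    barComplex k H ⟶ ((resFunctor H.subtype).mapHomologicalComplex _).obj (barComplex k G) where
  f n := freeInclusion H n
  comm' i j hij := by
    obtain rfl : j + 1 = i := hij
    refine Eq.trans ?_ ((freeInclusion_comp_map_d H j).trans ?_)
    · exact congrArg (fun f => freeInclusion H (j + 1) ≫ (resFunctor H.subtype).map f)
        (barComplex.d_def ..)
    · exact congrArg (fun f => f ≫ freeInclusion H j) (barComplex.d_def ..).symm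

/-- `A ⟶ Coind_H^G (Res A)`, `a ↦ (g ↦ g • a)`. -/
noncomputable def coindUnit : A ⟶ coind H.subtype (res H.subtype A) :=
  resCoindHomEquiv.{0} H.subtype A (res H.subtype A) (𝟙 _)

/-- Each coset contributes `g • (g⁻¹ • a) = a`, so the trace counts cosets. -/
theorem coindUnit_comp_trace [Finite G] :
    coindUnit H A ≫ GroupTransfer.trace H A = (H.index : k) • 𝟙 A := by
  refine Rep.hom_ext ?_
  ext a
  change ∑ᶠ q : G ⧸ H, GroupTransfer.traceTerm H A ((coindUnit H A).hom a) q = _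
  have h : ∀ q : G ⧸ H, GroupTransfer.traceTerm H A ((coindUnit H A).hom a) q = a := by
    intro q
    induction q using QuotientGroup.induction_on with
    | H g =>
      change A.ρ g (A.ρ g⁻¹ a) = a
      simp
  simp only [h]
  have := Fintype.ofFinite (G ⧸ H)
  rw [finsum_eq_sum_of_fintype, Finset.sum_const, Finset.card_univ, ← Nat.card_eq_fintype_card,
    ← Nat.cast_smul_eq_nsmul k]
  rfl

/-- The restriction of the bar resolution of `G`, as a resolution over `H`. -/
noncomputable abbrev resBarResolution : ProjectiveResolution (trivial k H k) :=
  (resFunctor H.subtype).mapProjectiveResolution (barResolution k G)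

/-- The augmentation passes through the standard complex, where the image of this generator is again
a basis vector and has augmentation `1`. -/
theorem barResolution_π_f_zero_single (x : Fin 0 → G) (g : G) :
    ((barResolution k G).π.f 0).hom (Finsupp.single x (.single g 1)) = (1 : k) := by
  have h1 : (diagonalSuccIsoFree k G 0).inv.hom (Finsupp.single x (MonoidAlgebra.single g 1)) =
      MonoidAlgebra.single (g • Fin.partialProd x) 1 := by
    simp only [diagonalSuccIsoFree, diagonalSuccIsoTensorTrivial, Iso.trans_inv, Rep.hom_comp,
      Representation.IntertwiningMap.comp_apply]
    have step1 : (Hom.hom (leftRegularTensorTrivialIsoFree k G (Fin 0 → G)).inv)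
        (Finsupp.single x (.single g 1)) =
          TensorProduct.tmul k (MonoidAlgebra.single g 1) (MonoidAlgebra.single x 1) :=
      Representation.leftRegularTensorTrivialIsoFree_symm_apply_single_single x g 1
    rw [step1]
    have key₁ := Representation.linearizeMap_single (k := k)
      (Action.diagonalSuccIsoTensorTrivial G 0).inv (g, x) ((1 : k) * 1)
    have key₂ := Representation.LinearizeMonoidal.μ_apply_single_single (k := k)
      (X := Action.leftRegular G) (Y := Action.trivial G (Fin 0 → G)) g x 1 1
    exact ((congrArg (fun z => (Representation.linearizeMap
      (Action.diagonalSuccIsoTensorTrivial G 0).inv) z) key₂).trans key₁).trans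
      ((congrArg _ (mul_one 1)).trans (congrArg (fun y => MonoidAlgebra.single y (1 : k))
        (Action.diagonalSuccIsoTensorTrivial_inv_hom_apply g x)))
  have h2 : (barResolution k G).π.f 0 = (diagonalSuccIsoFree k G 0).inv ≫ standardComplex.ε k G := rfl
  rw [h2]
  refine (congrArg (standardComplex.ε k G).hom h1).trans ?_
  simp [standardComplex.ε]

/-- Makes the inclusion of bar complexes a lift of the identity of the trivial module, as the
comparison of Ext groups requires. -/
theorem barComplexInclusion_f_zero_comp :
    (barComplexInclusion (k := k) H).f 0 ≫ (resBarResolution (k := k) H).π.f 0 =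
      (barResolution k H).π.f 0 := by
  refine free_ext k H _ _ _ fun x => ?_
  refine Eq.trans ?_ (barResolution_π_f_zero_single (k := k) (G := H) x 1).symm
  refine Eq.trans ?_ (barResolution_π_f_zero_single (k := k) (fun i => (x i : G)) 1)
  have h : (resBarResolution (k := k) H).π.f 0 =
      (resFunctor H.subtype).map ((barResolution k G).π.f 0) := rfl
  refine (congrArg (fun f => f.hom ((freeInclusion (k := k) H 0).hom
    (Finsupp.single x (.single 1 1)))) h).trans ?_
  exact congrArg ((barResolution k G).π.f 0).hom (freeInclusion_single H 0 x 1 1)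

/-- The composite isomorphism has the shape of `coindIso`: `e` and `b` compute Ext from the two
resolutions and `p` compares them, so `h₁` eliminates `p` and leaves an identity of cochain maps in
cohomology, `h₂`. -/
theorem CategoryTheory.comp_trans_symm_hom_eq {C : Type*} [Category* C] {X Y Z W V E : C}
    {u : X ⟶ Y} {a : Y ≅ Z} {q : W ≅ V} {b : E ≅ V} {e : E ≅ Z} {r : X ⟶ W} {p : Z ⟶ V}
    (h₁ : e.hom ≫ p = b.hom) (h₂ : (u ≫ a.hom) ≫ p = r ≫ q.hom) :
    u ≫ (a ≪≫ ((q ≪≫ b.symm) ≪≫ e).symm).hom = r := by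
  rw [← Iso.eq_inv_comp] at h₁
  subst h₁
  rw [← Category.assoc, ← Iso.comp_inv_eq] at h₂
  rw [Iso.comp_inv_eq] at h₂
  simp only [Iso.trans_hom, Iso.symm_hom, Iso.trans_inv, Iso.symm_inv]
  rw [← Category.assoc, ← Category.assoc, ← Category.assoc, Iso.comp_inv_eq, ← h₂]

/-- Transposing a map into the coinduced module evaluates it at `1`, and the unit followed by
evaluation at `1` is the identity. What remains of the cochain `f` is its restriction to `H^n`. -/
theorem freeInclusion_comp_resCoindHomEquiv_symm (n : ℕ) (f : (Fin n → G) → A) :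
    freeInclusion H n ≫ (resCoindHomEquiv.{0} H.subtype _ (res H.subtype A)).symm
      (freeLift k G (coind H.subtype (res H.subtype A)) fun g => (coindUnit H A).hom (f g)) =
    freeLift k H (res H.subtype A) fun h => f fun i => (h i : G) := by
  refine free_ext k H _ _ _ fun x => ?_
  have h1 : Representation.freeLift (coind H.subtype (res H.subtype A)).ρ
      (fun g => (coindUnit H A).hom (f g)) (Finsupp.single (fun i => (x i : G)) (.single 1 1)) =
        (coindUnit H A).hom (f fun i => (x i : G)) := by
    rw [Representation.freeLift_single_single, map_one, one_smul]
    rfl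
  have h2 : ((coindUnit H A).hom (f fun i => (x i : G))).1 1 = f fun i => (x i : G) := by
    change A.ρ 1 _ = _
    simp
  have h3 : Representation.freeLift (res H.subtype A).ρ (fun h : Fin n → H => f fun i => (h i : G))
      (Finsupp.single x (.single 1 1)) = f fun i => (x i : G) := by
    rw [Representation.freeLift_single_single, map_one, one_smul]
    rfl
  have h4 := congrArg (fun y => (Representation.freeLift (coind H.subtype (res H.subtype A)).ρ
    (fun g => (coindUnit H A).hom (f g)) y).1 1) (freeInclusion_single (k := k) H n x 1 1)
  exact (h4.trans ((congrArg (fun y => y.1 1) h1).trans h2)).trans h3.symm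

theorem cochainsMap_coindUnit_comp :
    (groupCohomology.cochainsMap (MonoidHom.id G) (coindUnit H A) ≫
      (groupCohomology.inhomogeneousCochainsIso (coind.{0, 0, 0, 0} H.subtype (res H.subtype A)) ≪≫
        (groupCohomology.linearYonedaObjResProjectiveResolutionIso (barResolution k G)
          (res H.subtype A)).symm).hom) ≫
        ChainComplex.linearYonedaObjMap (barComplexInclusion H) (res H.subtype A) =
    groupCohomology.cochainsMap (A := A) (B := res H.subtype A) H.subtype (𝟙 _) ≫
      (groupCohomology.inhomogeneousCochainsIso (res H.subtype A)).hom := by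
  refine HomologicalComplex.hom_ext _ _ fun n => ModuleCat.hom_ext (LinearMap.ext fun f => ?_)
  refine Eq.trans ?_ (freeInclusion_comp_resCoindHomEquiv_symm H A n f)
  rfl

/-- Shapiro's isomorphism uses the restricted bar resolution of `G`. Moving to the bar resolution of
`H` by the comparison map reduces the claim to the cochain identity `cochainsMap_coindUnit_comp`. -/
theorem map_coindUnit_comp_coindIso_hom (n : ℕ) :
    groupCohomology.map (MonoidHom.id G) (coindUnit H A) n ≫
      (groupCohomology.coindIso (res H.subtype A) n).hom =
    groupCohomology.map (A := A) (B := res H.subtype A) H.subtype (𝟙 _) n := by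
  have h := ProjectiveResolution.isoExt_hom_comp_homologyMap (R := k) (barResolution k H)
    (resBarResolution H) (barComplexInclusion H) (barComplexInclusion_f_zero_comp H) n
    (res H.subtype A)
  refine CategoryTheory.comp_trans_symm_hom_eq h ?_
  refine (congrArg (· ≫ _) (HomologicalComplex.homologyMap_comp _ _ n).symm).trans ?_
  refine (HomologicalComplex.homologyMap_comp _ _ n).symm.trans ?_
  refine Eq.trans ?_ (HomologicalComplex.homologyMap_comp _ _ n)
  exact congrArg (fun f => HomologicalComplex.homologyMap f n) (cochainsMap_coindUnit_comp H A)

/-- Clear on cochains; it passes to cocycles because they embed in cochains, and to cohomology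
because cocycles surject onto it. -/
theorem groupCohomology.map_id_smul_id (r : k) (n : ℕ) :
    groupCohomology.map (A := A) (B := A) (MonoidHom.id G) (r • 𝟙 A) n = r • 𝟙 _ := by
  have h : groupCohomology.cocyclesMap (A := A) (B := A) (MonoidHom.id G) (r • 𝟙 A) n =
      r • 𝟙 _ := by
    rw [← cancel_mono (groupCohomology.iCocycles A n), HomologicalComplex.cyclesMap_i,
      Linear.smul_comp, Category.id_comp]
    rfl
  have : Epi (groupCohomology.π A n) :=
    inferInstanceAs (Epi ((groupCohomology.inhomogeneousCochains A).homologyπ n))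
  rw [← cancel_epi (groupCohomology.π A n), groupCohomology.π_map, h, Linear.smul_comp,
    Category.id_comp, Linear.comp_smul, Category.comp_id]

theorem GroupTransfer.map_subtype_comp_transfer [Finite G] (n : ℕ) :
    groupCohomology.map (A := A) (B := res H.subtype A) H.subtype (𝟙 _) n ≫
      GroupTransfer.transfer H A n = (H.index : k) • 𝟙 _ := by
  rw [← map_coindUnit_comp_coindIso_hom, GroupTransfer.transfer, Category.assoc,
    Iso.hom_inv_id_assoc, ← groupCohomology.map_id_comp]
  exact (congrArg (fun f => groupCohomology.map (MonoidHom.id G) f n)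
    (coindUnit_comp_trace H A)).trans (groupCohomology.map_id_smul_id A _ n)

end Shapiro

/-! ### Action of transitive endomorphisms on stable classes -/

namespace LinkingSystem

variable {S : Type} [Group S] {F : FusionSystem S} (L : LinkingSystem F)

theorem coe_proj_comp {P Q R : L.Obj} (ψ : P ⟶ Q) (χ : Q ⟶ R) (x : P.sub) :
    L.proj (ψ ≫ χ) x = L.proj χ (L.proj ψ x) :=
  DFunLike.congr_fun (L.π_comp ψ χ) x

theorem coe_proj_iota [Finite S] {P : L.Obj} (x : P.sub) : (L.proj (L.iota P) x : S) = x := by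
  have h := DFunLike.congr_fun (L.π_δ (P := P) (Q := L.top) ⟨1, L.mem_transporter_top 1⟩) x
  refine (congrArg Subtype.val h).trans ?_
  change (1 : S) * x * 1⁻¹ = x
  simp

theorem omega_comp_iota [Finite S] {P Q : L.Obj} (ψ : P ⟶ Q) :
    L.omega (ψ ≫ L.iota Q) = L.omega ψ := by
  rw [omega_comp, omega_iota, one_mul]

variable [Finite S] {R M : Type} [CommRing R] [AddCommGroup M] [Module R M]
  (ρ : Representation R L.piOne M)

/-- The identity of `M`, as a map from the restriction to `P` of the `R[Q]`-module `M` to the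
`R[P]`-module `M`, for `P ≤ Q`. -/
noncomputable def repInclusion {P Q : Subgroup S} (h : P ≤ Q) :
    Rep.res (Subgroup.inclusion h) (L.rep ρ Q) ⟶ L.rep ρ P := 𝟙 _

/-- `Res^Q_P : H^k(Q, M) ⟶ H^k(P, M)`. -/
noncomputable def resInclusion {P Q : Subgroup S} (h : P ≤ Q) (k : ℕ) :
    groupCohomology (L.rep ρ Q) k ⟶ groupCohomology (L.rep ρ P) k :=
  groupCohomology.map (Subgroup.inclusion h) (L.repInclusion ρ h) k

theorem resS_comp_resInclusion {P Q : Subgroup S} (h : P ≤ Q) (k : ℕ) :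
    L.resS ρ Q k ≫ L.resInclusion ρ h k = L.resS ρ P k := by
  rw [resS, resInclusion, ← groupCohomology.map_comp]
  exact groupCohomology.map_congr rfl rfl k

/-- Stability speaks only of morphisms into `S` defined on a whole centric subgroup. Following `ψ`
by `ι_Q` gives such a morphism with the same underlying map and, as `ω(ι_Q) = 1`, the same action on
`M`. -/
theorem resS_comp_pull {P Q : L.Obj} (ψ : P ⟶ Q) {P₀ P₁ : Subgroup S} (h₀ : P₀ ≤ P.sub)
    (h : ∀ x : P₀, (L.proj ψ (Subgroup.inclusion h₀ x) : S) ∈ P₁) (k : ℕ) :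
    L.resS ρ P₁ k ≫ L.pull ρ ψ h₀ h k =
      (L.resS ρ ⊤ k ≫ L.pull ρ (ψ ≫ L.iota Q) (P₁ := ⊤) le_rfl (fun _ => Subgroup.mem_top _) k) ≫
        L.resInclusion ρ h₀ k := by
  rw [resS, resS, pull, pull, resInclusion, ← groupCohomology.map_comp, ← groupCohomology.map_comp,
    ← groupCohomology.map_comp]
  refine groupCohomology.map_congr ?_ ?_ k
  · ext x
    exact (L.coe_proj_iota _).symm.trans (congrArg Subtype.val (L.coe_proj_comp ψ (L.iota Q) _).symm)
  · refine LinearMap.ext fun m => ?_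
    change ρ (L.omega ψ)⁻¹ m = ρ (L.omega (ψ ≫ L.iota Q))⁻¹ m
    rw [omega_comp_iota]

theorem resS_comp_trS (P : Subgroup S) (k : ℕ) :
    L.resS ρ P k ≫ L.trS ρ P k = (P.index : R) • 𝟙 _ :=
  GroupTransfer.map_subtype_comp_transfer P (L.repS ρ) k

theorem trS_resS (P : Subgroup S) (k : ℕ) (x : groupCohomology (L.repS ρ) k) :
    L.trS ρ P k (L.resS ρ P k x) = (P.index : R) • x := by
  rw [← ModuleCat.comp_apply, resS_comp_trS]
  rfl

theorem pull_resS_of_mem_stable {k : ℕ} {x : groupCohomology (L.repS ρ) k} (hx : x ∈ L.stable ρ k)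
    {P Q : L.Obj} (ψ : P ⟶ Q) {P₀ P₁ : Subgroup S} (h₀ : P₀ ≤ P.sub)
    (h : ∀ x : P₀, (L.proj ψ (Subgroup.inclusion h₀ x) : S) ∈ P₁) :
    L.pull ρ ψ h₀ h k (L.resS ρ P₁ k x) = L.resS ρ P₀ k x := by
  have h1 := congrArg (fun f => f.hom x) (L.resS_comp_pull ρ ψ h₀ h k)
  have h2 := congrArg (fun f => f.hom x) (L.resS_comp_resInclusion ρ h₀ k)
  have h3 := hx P _ (L.π_mem (ψ ≫ L.iota Q)) (ψ ≫ L.iota Q) rfl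
  refine h1.trans (Eq.trans ?_ h2)
  exact congrArg (L.resInclusion ρ h₀ k).hom h3

/-- Induction on the chain: the subgroups `P_i` need not be centric, but each step is a restriction
of a morphism between centric subgroups. -/
theorem chain_pull_resS_of_mem_stable {k : ℕ} {x : groupCohomology (L.repS ρ) k}
    (hx : x ∈ L.stable ρ k) {P P' : Subgroup S} (c : L.Chain P P') :
    c.pull ρ k (L.resS ρ P' k x) = L.resS ρ P k x := by
  induction c with
  | nil P => rfl
  | cons Q ψ h₀ h₁ h c ih =>
    refine Eq.trans ?_ (L.pull_resS_of_mem_stable ρ hx ψ.hom h₀ (proj_mem_of_map_eq h₀ h))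
    exact congrArg (L.pull ρ ψ.hom h₀ (proj_mem_of_map_eq h₀ h) k).hom ih

theorem IsTransitiveEndo.apply_of_mem_stable {P : Subgroup S} {φ : P →* (⊤ : Subgroup S)}
    {lam : ∀ k, Module.End R (groupCohomology (L.repS ρ) k)} (hlam : L.IsTransitiveEndo ρ P φ lam)
    {k : ℕ} {x : groupCohomology (L.repS ρ) k} (hx : x ∈ L.stable ρ k) :
    lam k x = (P.index : R) • x := by
  obtain ⟨P', c, -, h⟩ := hlam
  have h1 : lam k x = L.trS ρ P k (c.pull ρ k (L.resS ρ P' k x)) := by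
    rw [h]
    rfl
  rw [h1, L.chain_pull_resS_of_mem_stable ρ hx c, trS_resS]

end LinkingSystem

/-! ### Counting points of the biset -/

section Biset

variable {S : Type} [Group S] {F : FusionSystem S} {Ω : Type*} [MulAction S Ω] [MulAction Sᵐᵒᵖ Ω]

theorem card_graphSubgroup (P : Subgroup S) (φ : P →* (⊤ : Subgroup S)) :
    Nat.card (graphSubgroup P φ) = Nat.card P := by
  have h : Function.Injective (P.subtype.prod ((⊤ : Subgroup S).subtype.comp φ)) :=
    fun x y h => Subtype.ext (congrArg Prod.fst h)
  exact (Nat.card_congr (MonoidHom.ofInjective h).toEquiv).symm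

/-- The graph of `φ` has order `|P|`, so each component has `|S|² / |P| = |S| · [S : P]` points. -/
theorem BisetDecomposition.card_eq [Finite S] (D : BisetDecomposition F Ω) :
    Nat.card Ω = Nat.card S * ∑ i, (D.P i).index := by
  rw [Nat.card_congr D.equiv, Nat.card_sigma, Finset.mul_sum]
  refine Finset.sum_congr rfl fun i _ => ?_
  have h1 := (graphSubgroup (D.P i) (D.φ i)).card_mul_index
  have h2 := (D.P i).card_mul_index
  rw [card_graphSubgroup, Nat.card_prod, ← h2, mul_assoc, h2] at h1
  have h3 := Nat.eq_of_mul_eq_mul_left (Nat.card_pos (α := D.P i)) h1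
  rw [Subgroup.index] at h3
  rw [h3, mul_comm]

theorem LinkingSystem.IsBisetEndo.apply_of_mem_stable [Finite S] {L : LinkingSystem F} {R M : Type}
    [CommRing R] [AddCommGroup M] [Module R M] {ρ : Representation R L.piOne M}
    {om : ∀ k, Module.End R (groupCohomology (L.repS ρ) k)} (hom : L.IsBisetEndo Ω ρ om)
    {k : ℕ} {x : groupCohomology (L.repS ρ) k} (hx : x ∈ L.stable ρ k) :
    om k x = ((Nat.card Ω / Nat.card S : ℕ) : R) • x := by
  obtain ⟨D, lam, hlam, h⟩ := hom
  rw [h, LinearMap.sum_apply, D.card_eq, Nat.mul_div_cancel_left _ Nat.card_pos, Nat.cast_sum,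
    Finset.sum_smul]
  exact Finset.sum_congr rfl fun i _ => (hlam i).apply_of_mem_stable L ρ hx

end Biset

/-! ### Finiteness, idempotent powers and the theorem -/

theorem finite_groupCohomology {k G : Type} [CommRing k] [Group G] [Finite G] (A : Rep.{0} k G)
    [Finite A] (n : ℕ) : Finite (groupCohomology A n) := by
  have : Finite (groupCohomology.cocycles A n) := by
    have hm : Mono (groupCohomology.iCocycles A n) :=
      inferInstanceAs (Mono ((groupCohomology.inhomogeneousCochains A).iCycles n))
    have : Finite ((groupCohomology.inhomogeneousCochains A).X n) :=
      inferInstanceAs (Finite ((Fin n → G) → A))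
    exact Finite.of_injective _ ((ModuleCat.mono_iff_injective _).1 hm)
  have he : Epi (groupCohomology.π A n) :=
    inferInstanceAs (Epi ((groupCohomology.inhomogeneousCochains A).homologyπ n))
  exact Finite.of_surjective _ ((ModuleCat.epi_iff_surjective _).1 he)

/-- The powers of `a` are eventually periodic by the pigeonhole principle; an exponent that is a
multiple of the period and lies beyond the preperiod gives an idempotent. -/
theorem exists_isIdempotentElem_pow {α : Type*} [Monoid α] [Finite α] (a : α) :
    ∃ N, 0 < N ∧ IsIdempotentElem (a ^ N) := by
  obtain ⟨i, j, hij, h⟩ : ∃ i j, i < j ∧ a ^ i = a ^ j := by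
    obtain ⟨i, j, hne, h⟩ := Finite.exists_ne_map_eq_of_infinite (fun n : ℕ => a ^ n)
    rcases lt_or_gt_of_ne hne with hlt | hlt
    exacts [⟨i, j, hlt, h⟩, ⟨j, i, hlt, h.symm⟩]
  obtain ⟨d, rfl⟩ := Nat.exists_eq_add_of_lt hij
  set e := d + 1 with he
  have step : ∀ t, a ^ (i + e * t) = a ^ i := by
    intro t
    induction t with
    | zero => simp
    | succ t ih =>
      rw [mul_add_one, ← add_assoc, pow_add, ih, ← pow_add, he, ← add_assoc, ← h]
  -- A positive multiple of the period `e` that is at least `i`, so that doubling it shifts by whole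
  -- periods within the periodic range.
  refine ⟨e * (i + 1), by positivity, ?_⟩
  have hle : i ≤ e * (i + 1) := by nlinarith
  obtain ⟨r, hr⟩ := Nat.exists_eq_add_of_le hle
  rw [IsIdempotentElem, ← pow_add]
  conv_lhs => rw [show e * (i + 1) + e * (i + 1) = i + e * (i + 1) + r by omega, pow_add, step,
    ← pow_add, ← hr]

theorem isUnit_natCast_zLocal (p : ℕ) [Fact p.Prime] {m : ℕ} (h : ¬ p ∣ m) :
    IsUnit (m : ZLocal p) := by
  have : (m : ℤ) ∈ (Ideal.span {(p : ℤ)}).primeCompl := by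
    intro hm
    exact h (Int.natCast_dvd_natCast.1 (Ideal.mem_span_singleton.1 hm))
  simpa using IsLocalization.map_units (ZLocal p) (⟨(m : ℤ), this⟩ : (Ideal.span {(p : ℤ)}).primeCompl)

theorem proposition4p8 (p : ℕ) [Fact p.Prime] {S : Type} [Group S] [Finite S] (hS : IsPGroup p S)
    (F : FusionSystem S) (hF : F.IsSaturated p) (L : LinkingSystem F)
    {M : Type} [AddCommGroup M] [Finite M] (hM : IsPGroup p (Multiplicative M))
    [Module (ZLocal p) M] (ρ : Representation (ZLocal p) L.piOne M)
    {Ω : Type*} [Finite Ω] [MulAction S Ω] [MulAction Sᵐᵒᵖ Ω] [SMulCommClass S Sᵐᵒᵖ Ω]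
    (hΩ : IsCharacteristicBiset F Ω p)
    (om : ∀ k : ℕ, Module.End (ZLocal p) (groupCohomology (L.repS ρ) k))
    (hom : L.IsBisetEndo Ω ρ om) :
    ∃ c : ZLocal p, c * (Nat.card Ω : ZLocal p) = (Nat.card S : ZLocal p) ∧
      ∀ k : ℕ, ∃ N : ℕ, 0 < N ∧ IsIdempotentElem ((c • om k) ^ N) ∧
        L.stable ρ k ≤ LinearMap.range ((c • om k) ^ N) := by
  obtain ⟨D⟩ := hΩ.generated
  set m := Nat.card Ω / Nat.card S with hm
  have hcard : Nat.card Ω = Nat.card S * m := by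
    rw [hm, D.card_eq, Nat.mul_div_cancel_left _ Nat.card_pos]
  obtain ⟨u, hu⟩ := isUnit_natCast_zLocal p hΩ.nondegenerate
  have hum : (↑u⁻¹ : ZLocal p) * (m : ZLocal p) = 1 := by rw [← hu, Units.inv_mul]
  -- The scalar `|S|/|Ω|` is the inverse of the unit `m = |Ω|/|S|`.
  refine ⟨↑u⁻¹, ?_, fun k => ?_⟩
  · rw [hcard, Nat.cast_mul, mul_left_comm, hum, mul_one]
  have : Finite (groupCohomology (L.repS ρ) k) := by
    have : Finite (L.repS ρ) := inferInstanceAs (Finite M)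
    exact finite_groupCohomology _ k
  have : Finite (Module.End (ZLocal p) (groupCohomology (L.repS ρ) k)) :=
    DFunLike.finite _
  obtain ⟨N, hN, hidem⟩ := exists_isIdempotentElem_pow ((↑u⁻¹ : ZLocal p) • om k)
  -- A stable class is its own preimage, being fixed by the rescaled endomorphism and so by its
  -- powers.
  refine ⟨N, hN, hidem, fun x hx => ⟨x, ?_⟩⟩
  have hfix : ((↑u⁻¹ : ZLocal p) • om k) x = x := by
    rw [LinearMap.smul_apply, hom.apply_of_mem_stable hx, smul_smul, hum, one_smul]
  rw [Module.End.pow_apply]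
  exact Function.iterate_fixed hfix N
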